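/- Let $R$ be a commutative Noetherian ring, $I$ an ideal of $R$, and $M$ an $R$-module with $\operatorname{Supp} M \subseteq V(I)=\{\mathfrak p\in\operatorname{Spec}R : \mathfrak p\supseteq I\}$. Suppose that $M$ is an $\mathrm{FD}_{\leq 1}$ module, i.e. $M$ has a finitely generated submodule $N$ such that $\dim (M/N)\leq 1$, where the dimension of a module is the Krull dimension of its support (and the zero module has dimension $-\infty$). Then the following statements are equivalent: (i) $M$ is $I$-cofinite, i.e. $\operatorname{Supp} M\subseteq V(I)$ and $\operatorname{Ext}^i_R(R/I,M)$ is a finitely generated $R$-module for all $i\geq 0$; (ii) the $R$-modules $\operatorname{Hom}_R(R/I,M)$ and $\operatorname{Ext}^1_R(R/I,M)$ are finitely generated. -/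

import Mathlib

universe u

/-- `M` is an `FD_{≤ n}` module: an extension `0 → N → M → M ⧸ N → 0` of a finitely generated
module `N` by a module `M ⧸ N` of Krull dimension (the dimension of its support) at most `n`.
The zero module has dimension `⊥`, so `n = ⊥` plays the role of `n = -1`. -/
def IsFDLE (R : Type u) [CommRing R] (n : WithBot ℕ∞) (M : Type u) [AddCommGroup M]
    [Module R M] : Prop :=
  ∃ N : Submodule R M, N.FG ∧ Module.supportDim R (M ⧸ N) ≤ n

/-- The `R`-module `Ext^i_R(R/I, M)`. -/
abbrev ExtQuot {R : Type u} [CommRing R] (I : Ideal R) (M : Type u) [AddCommGroup M]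
    [Module R M] (i : ℕ) : Type u :=
  CategoryTheory.Abelian.Ext (ModuleCat.of R (R ⧸ I)) (ModuleCat.of R M) i

/-- `M` is `I`-cofinite: `Supp M ⊆ V(I)` and `Ext^i_R(R/I, M)` is a finitely generated `R`-module
for every `i ≥ 0`. -/
def IsCofiniteModule {R : Type u} [CommRing R] (I : Ideal R) (M : Type u) [AddCommGroup M]
    [Module R M] : Prop :=
  Module.support R M ⊆ PrimeSpectrum.zeroLocus (I : Set R) ∧
    ∀ i : ℕ, Module.Finite R (ExtQuot I M i)

/-!
Let `N` be a finitely generated submodule of `M` with `dim (M ⧸ N) ≤ 1`. All `Ext^i_R(R/I, N)` are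
finitely generated, so the long exact sequence passes the hypotheses from `M` to `M ⧸ N` and the
conclusion back, and `M` may be assumed to have dimension at most one. It is then shown, for `d = -1`,
`0`, `1` in turn, that an `I`-torsion module of dimension at most `d` for which `Ext^i_R(R/I, M)` is
finitely generated for all `i ≤ d` has all these modules finitely generated
(`ExtQuotFiniteOfLT.succ`).

Work modulo modules of dimension less than `d`. There `0 :_M I`, being finitely generated of
dimension at most `d`, is Artinian (`isArtinianMod_of_finite`), and a dual form of Hilbert's basis
theorem makes the whole `I`-torsion module `M` Artinian (`IsArtinianMod.of_torsionBySet_ideal`).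
This permits induction on two quantities: the annihilator, which may grow, and the submodule modulo
modules of dimension less than `d`, which may shrink. If `I M = 0` then `M = 0 :_M I` is finitely
generated. Otherwise take `x ∈ I` with `x M ≠ 0`. The submodule `0 :_M x` has a larger annihilator,
so it is cofinite. If `x M` is strictly smaller than `M` modulo lower dimension, it is cofinite by
induction, and so is the extension `M`. If not, `M ⧸ x M` has dimension less than `d` and is cofinite
by the preceding value of `d`; then `M` is cofinite because multiplication by `x` is zero on
`Ext^i_R(R/I, M)` (`finite_extQuot_of_ker_of_quotient_range`).
-/

/-! ### Submodules up to modules supported in a set of primes -/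

section ArtinianMod

variable {R : Type*} [CommRing R] {Z : Set (PrimeSpectrum R)}
  {M : Type*} [AddCommGroup M] [Module R M]

/-- `N` is contained in `N'` up to modules supported in `Z`: the image of `N` in `M ⧸ N'` has
support in `Z`. The condition is spelled out elementwise, so that no localization is needed. -/
def Submodule.LEMod (Z : Set (PrimeSpectrum R)) (N N' : Submodule R M) : Prop :=
  ∀ p ∉ Z, ∀ n ∈ N, ∃ r ∉ p.asIdeal, r • n ∈ N'

lemma Submodule.LEMod.of_le {N N' : Submodule R M} (h : N ≤ N') : N.LEMod Z N' :=
  fun p _ n hn => ⟨1, (Ideal.ne_top_iff_one _).1 p.2.ne_top, by simpa using h hn⟩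

lemma Submodule.LEMod.trans {N₁ N₂ N₃ : Submodule R M} (h : N₁.LEMod Z N₂)
    (h' : N₂.LEMod Z N₃) : N₁.LEMod Z N₃ := by
  intro p hp n hn
  obtain ⟨r, hr, hrn⟩ := h p hp n hn
  obtain ⟨s, hs, hsn⟩ := h' p hp _ hrn
  exact ⟨s * r, p.2.mul_notMem hs hr, by rwa [mul_smul]⟩

lemma Submodule.lEMod_top_iff {N : Submodule R M} :
    (⊤ : Submodule R M).LEMod Z N ↔ Module.support R (M ⧸ N) ⊆ Z := by
  constructor
  · intro h p hp
    by_contra hpZ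
    refine Module.notMem_support_iff'.2 (fun m => ?_) hp
    obtain ⟨m, rfl⟩ := N.mkQ_surjective m
    obtain ⟨r, hr, hrm⟩ := h p hpZ m trivial
    exact ⟨r, hr, by rw [← map_smul]; exact (Submodule.Quotient.mk_eq_zero N).2 hrm⟩
  · intro h p hp m _
    obtain ⟨r, hr, hrm⟩ := Module.notMem_support_iff'.1 (fun hp' => hp (h hp')) (N.mkQ m)
    exact ⟨r, hr, (Submodule.Quotient.mk_eq_zero N).1 (by rwa [← map_smul] at hrm)⟩

/-- `M` is Artinian up to modules supported in `Z`: every descending chain of submodules of `M` is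
eventually constant up to such modules. For `Z = ∅` these are the Artinian modules. -/
def IsArtinianMod (Z : Set (PrimeSpectrum R)) (M : Type*) [AddCommGroup M] [Module R M] : Prop :=
  ∀ f : ℕ → Submodule R M, Antitone f → ∃ n, ∀ m ≥ n, (f n).LEMod Z (f m)

lemma IsArtinianMod.wellFounded (h : IsArtinianMod Z M) :
    WellFounded fun N' N : Submodule R M => N' ≤ N ∧ ¬ N.LEMod Z N' := by
  rw [wellFounded_iff_isEmpty_descending_chain]
  refine ⟨fun ⟨f, hf⟩ => ?_⟩
  obtain ⟨n, hn⟩ := h f (antitone_nat_of_succ_le fun k => (hf k).1)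
  exact (hf n).2 (hn _ n.le_succ)

variable {A B C : Type*} [AddCommGroup A] [Module R A] [AddCommGroup B] [Module R B]
  [AddCommGroup C] [Module R C]

lemma IsArtinianMod.of_injective (h : IsArtinianMod Z B) (f : A →ₗ[R] B)
    (hf : Function.Injective f) : IsArtinianMod Z A := by
  intro N hN
  obtain ⟨n, hn⟩ := h (fun k => (N k).map f) fun i j hij => Submodule.map_mono (hN hij)
  refine ⟨n, fun m hm p hp a ha => ?_⟩
  obtain ⟨r, hr, b, hb, hba⟩ := hn m hm p hp (f a) ⟨a, ha, rfl⟩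
  rw [← map_smul] at hba
  exact ⟨r, hr, hf hba ▸ hb⟩

lemma IsArtinianMod.of_exact {f : A →ₗ[R] B} {g : B →ₗ[R] C} (hfg : Function.Exact f g)
    (hA : IsArtinianMod Z A) (hC : IsArtinianMod Z C) : IsArtinianMod Z B := by
  intro N hN
  obtain ⟨n₁, hn₁⟩ := hA (fun k => (N k).comap f) fun i j hij => Submodule.comap_mono (hN hij)
  obtain ⟨n₂, hn₂⟩ := hC (fun k => (N k).map g) fun i j hij => Submodule.map_mono (hN hij)
  refine ⟨max n₁ n₂, fun m hm p hp b hb => ?_⟩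
  have hm₁ := (le_max_left _ _).trans hm
  have hm₂ := (le_max_right _ _).trans hm
  obtain ⟨r, hr, b', hb', hbb'⟩ :=
    hn₂ m hm₂ p hp (g b) ⟨b, hN (le_max_right _ _) hb, rfl⟩
  obtain ⟨a, ha⟩ := (hfg (r • b - b')).1 (by simp [hbb'])
  have haN : f a ∈ N n₁ := by
    rw [ha]
    exact (N n₁).sub_mem ((N n₁).smul_mem r (hN (le_max_left _ _) hb)) (hN hm₁ hb')
  obtain ⟨s, hs, hsa⟩ := hn₁ m hm₁ p hp a haN
  refine ⟨s * r, p.2.mul_notMem hs hr, ?_⟩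
  have : s • f a ∈ N m := by simpa using hsa
  rw [ha, smul_sub] at this
  simpa [mul_smul] using (N m).add_mem this ((N m).smul_mem s hb')

/-- Any chain in `R ⧸ p` reaches `0` or consists of nonzero submodules; the quotient of `R ⧸ p` by
a nonzero submodule is supported in the primes strictly above `p`. -/
lemma isArtinianMod_quotient_prime (p : PrimeSpectrum R) (hp : ∀ q, p < q → q ∈ Z) :
    IsArtinianMod Z (R ⧸ p.asIdeal) := by
  intro N hN
  by_cases h : ∃ n, N n = ⊥
  · obtain ⟨n, hn⟩ := h
    exact ⟨n, fun m _ => .of_le (by simp [hn])⟩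
  push Not at h
  refine ⟨0, fun m _ q hq a _ => ?_⟩
  obtain ⟨y, hy, hy0⟩ := (N m).ne_bot_iff.1 (h m)
  obtain ⟨y, rfl⟩ := Ideal.Quotient.mk_surjective y
  obtain ⟨a, rfl⟩ := Ideal.Quotient.mk_surjective a
  rw [Ne, Ideal.Quotient.eq_zero_iff_mem] at hy0
  by_cases hpq : p ≤ q
  · have hqp : q ≤ p := by
      by_contra hqp
      exact hq (hp q (lt_of_le_not_ge hpq hqp))
    refine ⟨y, fun hyq => hy0 (hqp hyq), ?_⟩
    have := (N m).smul_mem a hy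
    rwa [Algebra.smul_def, Ideal.Quotient.algebraMap_eq, mul_comm] at this
  · obtain ⟨r, hr, hrq⟩ := SetLike.not_le_iff_exists.1 (show ¬ p.asIdeal ≤ q.asIdeal from hpq)
    refine ⟨r, hrq, ?_⟩
    rw [Algebra.smul_def, Ideal.Quotient.algebraMap_eq, Ideal.Quotient.eq_zero_iff_mem.2 hr,
      zero_mul]
    exact (N m).zero_mem

lemma isArtinianMod_of_finite [IsNoetherianRing R] [Module.Finite R M]
    (hM : ∀ p ∈ Module.support R M, ∀ q, p < q → q ∈ Z) : IsArtinianMod Z M := by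
  revert hM
  induction ‹Module.Finite R M› using IsNoetherianRing.induction_on_isQuotientEquivQuotientPrime R
    with
  | subsingleton N => exact fun _ f _ => ⟨0, fun m _ => .of_le (Subsingleton.elim _ _).le⟩
  | quotient N p e =>
    intro h
    refine (isArtinianMod_quotient_prime p (h p ?_)).of_injective e.toLinearMap e.injective
    rw [e.support_eq, Module.mem_support_iff_of_finite, Ideal.annihilator_quotient]
  | exact N₁ N₂ N₃ f g hf hg hfg h₁ h₃ =>
    exact fun h => .of_exact hfg (h₁ fun p hp => h p (Module.support_subset_of_injective f hf hp))
      (h₃ fun p hp => h p (Module.support_subset_of_surjective g hg hp))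

/-- The dual of Hilbert's basis theorem. A submodule `N` is determined by the submodules
`x ^ k N ∩ (0 :_M x)`, which decrease as `k` grows, so a chain of submodules of `M` gives a doubly
indexed chain in `0 :_M x`. -/
lemma IsArtinianMod.of_torsionBy (x : R) (hx : ∀ m : M, ∃ k : ℕ, x ^ k • m = 0)
    (h : IsArtinianMod Z (Submodule.torsionBy R M x)) : IsArtinianMod Z M := by
  intro N hN
  set L : ℕ → ℕ → Submodule R (Submodule.torsionBy R M x) := fun k j =>
    ((N j).map (LinearMap.lsmul R M (x ^ k))).comap (Submodule.torsionBy R M x).subtype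
  have hLj (k : ℕ) : Antitone (L k) := fun i j hij =>
    Submodule.comap_mono (Submodule.map_mono (hN hij))
  have hLk (j : ℕ) : Antitone fun k => L k j := by
    refine antitone_nat_of_succ_le fun k => Submodule.comap_mono ?_
    rintro _ ⟨n, hn, rfl⟩
    exact ⟨x • n, (N j).smul_mem x hn, by simp [pow_succ, mul_smul, smul_comm x]⟩
  obtain ⟨a, ha⟩ := h (fun j => L j j) fun i j hij => (hLj _ hij).trans (hLk i hij)
  choose b hb using fun k => h (L k) (hLj k)
  -- The diagonal takes care of all `k ≥ a` at once; only finitely many `k` remain.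
  set c := max a ((Finset.range a).sup b)
  have key (k j : ℕ) (hj : c ≤ j) : (L k c).LEMod Z (L k j) := by
    rcases lt_or_ge k a with hk | hk
    · have hbc : b k ≤ c := (Finset.le_sup (Finset.mem_range.2 hk)).trans (le_max_right _ _)
      exact .trans (.of_le (hLj k hbc)) (hb k j (hbc.trans hj))
    · refine .trans (.of_le ((hLj k (le_max_left _ _)).trans (hLk a hk)))
        (.trans (ha (max k j) (hk.trans (le_max_left _ _))) (.of_le ?_))
      exact (hLk _ (le_max_left k j)).trans (hLj k (le_max_right k j))
  refine ⟨c, fun j hj p hp n hn => ?_⟩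
  obtain ⟨k, hk⟩ := hx n
  induction k generalizing n with
  | zero => exact ⟨1, (Ideal.ne_top_iff_one _).1 p.2.ne_top, by simp_all⟩
  | succ k ih =>
    have hy : x ^ k • n ∈ Submodule.torsionBy R M x := by
      rwa [Submodule.mem_torsionBy_iff, ← mul_smul, ← pow_succ']
    obtain ⟨r, hr, n', hn', hrn⟩ := key k j hj p hp ⟨_, hy⟩ ⟨n, hn, rfl⟩
    have hrn : x ^ k • n' = r • x ^ k • n := hrn
    obtain ⟨s, hs, hsn⟩ := ih (r • n - n') ((N c).sub_mem ((N c).smul_mem r hn) (hN hj hn'))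
      (by rw [smul_sub, hrn, smul_comm, sub_self])
    refine ⟨s * r, p.2.mul_notMem hs hr, ?_⟩
    rw [smul_sub] at hsn
    simpa [mul_smul] using (N j).add_mem hsn ((N j).smul_mem s hn')

lemma IsArtinianMod.of_torsionBySet (s : Finset R) (hs : ∀ x ∈ s, ∀ m : M, ∃ k : ℕ, x ^ k • m = 0)
    (h : IsArtinianMod Z (Submodule.torsionBySet R M (s : Set R))) : IsArtinianMod Z M := by
  classical
  induction s using Finset.induction_on generalizing M with
  | empty =>
    refine h.of_injective (LinearMap.id.codRestrict _ fun m => ?_)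
      fun _ _ hab => congrArg Subtype.val hab
    simp [Submodule.mem_torsionBySet_iff]
  | insert x s hxs ih =>
    refine .of_torsionBy x (hs x (by simp)) (ih (fun y hy m => ?_) ?_)
    · obtain ⟨k, hk⟩ := hs y (by simp [hy]) m
      exact ⟨k, Subtype.ext hk⟩
    · refine h.of_injective (((Submodule.torsionBy R M x).subtype ∘ₗ
        Submodule.subtype _).codRestrict _ fun m => ?_) fun a b hab =>
        Subtype.ext <| Subtype.ext <| by simpa using congrArg Subtype.val hab
      rw [Submodule.mem_torsionBySet_iff]
      rintro ⟨y, hy⟩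
      rcases Finset.mem_insert.1 hy with rfl | hy
      · exact m.1.2
      · exact congrArg Subtype.val ((Submodule.mem_torsionBySet_iff _ _).1 m.2 ⟨y, hy⟩)

/-- Elements of an ideal whose zero locus contains the support of `M` are locally nilpotent
on `M`. -/
lemma exists_pow_smul_eq_zero_of_support_subset {I : Ideal R}
    (hI : Module.support R M ⊆ PrimeSpectrum.zeroLocus (I : Set R)) {x : R} (hx : x ∈ I) (m : M) :
    ∃ k : ℕ, x ^ k • m = 0 := by
  have : x ∈ (Ideal.torsionOf R M m).radical := by
    rw [Ideal.radical_eq_sInf, Submodule.mem_sInf]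
    rintro p ⟨hp, hprime⟩
    refine hI (a := ⟨p, hprime⟩) (Module.mem_support_iff'.2 ⟨m, fun r hr h => hr (hp ?_)⟩) hx
    simpa using h
  exact this

lemma IsArtinianMod.of_torsionBySet_ideal [IsNoetherianRing R] {I : Ideal R}
    (hI : Module.support R M ⊆ PrimeSpectrum.zeroLocus (I : Set R))
    (h : IsArtinianMod Z (Submodule.torsionBySet R M (I : Set R))) : IsArtinianMod Z M := by
  obtain ⟨s, rfl⟩ := IsNoetherian.noetherian I
  refine .of_torsionBySet s (fun x hx =>
    exists_pow_smul_eq_zero_of_support_subset hI (Ideal.subset_span hx)) ?_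
  rwa [Submodule.torsionBySet_eq_torsionBySet_span]

end ArtinianMod

/-! ### Finiteness of `Ext` along short exact sequences -/

section FiniteExt

lemma LinearMap.exact_ker_subtype_rangeRestrict {R A B : Type*} [Ring R] [AddCommGroup A]
    [Module R A] [AddCommGroup B] [Module R B] (f : A →ₗ[R] B) :
    Function.Exact (LinearMap.ker f).subtype f.rangeRestrict := fun a => by
  simp [Subtype.ext_iff]

open CategoryTheory Abelian

variable {R : Type u} [CommRing R] {A B C : Type u}
  [AddCommGroup A] [Module R A] [AddCommGroup B] [Module R B] [AddCommGroup C] [Module R C]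

lemma Module.Finite.of_exact_middle {A B C : Type*} [AddCommGroup A] [Module R A] [AddCommGroup B]
    [Module R B] [AddCommGroup C] [Module R C] [IsNoetherianRing R] (f : A →ₗ[R] B)
    (g : B →ₗ[R] C) (h : ∀ b, g b = 0 → ∃ a, f a = b) [Module.Finite R A] [Module.Finite R C] :
    Module.Finite R B := by
  refine ⟨Submodule.fg_of_fg_map_of_fg_inf_ker g (IsNoetherian.noetherian _) ?_⟩
  have := (Submodule.fg_top (LinearMap.range f)).1 (Module.Finite.fg_top)
  refine .of_le this ?_
  rintro b ⟨-, hb⟩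
  exact h b hb

/-- The short complex of `R`-modules given by a pair of exact linear maps. -/
abbrev ModuleCat.shortComplexOfExact {f : A →ₗ[R] B} {g : B →ₗ[R] C}
    (hfg : Function.Exact f g) : ShortComplex (ModuleCat.{u} R) :=
  .mk (ModuleCat.ofHom f) (ModuleCat.ofHom g)
    (ModuleCat.hom_ext (LinearMap.ext hfg.apply_apply_eq_zero))

lemma ModuleCat.shortExact_of_exact {f : A →ₗ[R] B} {g : B →ₗ[R] C}
    (hfg : Function.Exact f g) (hf : Function.Injective f) (hg : Function.Surjective g) :
    (ModuleCat.shortComplexOfExact hfg).ShortExact where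
  exact := (ShortComplex.moduleCat_exact_iff _).2 fun b hb => (hfg b).1 hb
  mono_f := (ModuleCat.mono_iff_injective _).2 hf
  epi_g := (ModuleCat.epi_iff_surjective _).2 hg

lemma finite_ext_of_linearEquiv (X : ModuleCat.{u} R) (e : A ≃ₗ[R] B) {i : ℕ}
    (hA : Module.Finite R (Ext X (.of R A) i)) : Module.Finite R (Ext X (.of R B) i) := by
  refine .of_surjective
    (Ext.postcompOfLinear (Ext.mk₀ (ModuleCat.ofHom e.toLinearMap)) R X (add_zero i)) fun x => ?_
  refine ⟨x.comp (Ext.mk₀ (ModuleCat.ofHom e.symm.toLinearMap)) (add_zero i), ?_⟩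
  have : ModuleCat.ofHom e.symm.toLinearMap ≫ ModuleCat.ofHom e.toLinearMap = 𝟙 _ := by
    ext; simp
  simp [this]

lemma finite_ext_zero_of_injective [IsNoetherianRing R] (X : ModuleCat.{u} R) {f : A →ₗ[R] B}
    (hf : Function.Injective f)
    (hB : Module.Finite R (Ext X (.of R B) 0)) : Module.Finite R (Ext X (.of R A) 0) :=
  have : Mono (ModuleCat.ofHom f) := (ModuleCat.mono_iff_injective _).2 hf
  .of_injective (Ext.postcompOfLinear (Ext.mk₀ (ModuleCat.ofHom f)) R X (add_zero 0))
    (Ext.postcomp_mk₀_injective_of_mono X (ModuleCat.ofHom f))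

variable [IsNoetherianRing R]

lemma finite_ext_middle (X : ModuleCat.{u} R) {f : A →ₗ[R] B} {g : B →ₗ[R] C}
    (hfg : Function.Exact f g) (hf : Function.Injective f) (hg : Function.Surjective g) {i : ℕ}
    (hA : Module.Finite R (Ext X (.of R A) i))
    (hC : Module.Finite R (Ext X (.of R C) i)) : Module.Finite R (Ext X (.of R B) i) :=
  have hS := ModuleCat.shortExact_of_exact hfg hf hg
  .of_exact_middle (Ext.postcompOfLinear (Ext.mk₀ (ModuleCat.ofHom f)) R X (add_zero i))
    (Ext.postcompOfLinear (Ext.mk₀ (ModuleCat.ofHom g)) R X (add_zero i))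
    fun x hx => Ext.covariant_sequence_exact₂ X hS x hx

lemma finite_ext_right (X : ModuleCat.{u} R) {f : A →ₗ[R] B} {g : B →ₗ[R] C}
    (hfg : Function.Exact f g) (hf : Function.Injective f) (hg : Function.Surjective g) {i : ℕ}
    (hB : Module.Finite R (Ext X (.of R B) i))
    (hA : Module.Finite R (Ext X (.of R A) (i + 1))) : Module.Finite R (Ext X (.of R C) i) :=
  have hS := ModuleCat.shortExact_of_exact hfg hf hg
  .of_exact_middle (Ext.postcompOfLinear (Ext.mk₀ (ModuleCat.ofHom g)) R X (add_zero i))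
    (Ext.postcompOfLinear hS.extClass R X rfl)
    fun x hx => Ext.covariant_sequence_exact₃ X hS x rfl hx

lemma finite_ext_left (X : ModuleCat.{u} R) {f : A →ₗ[R] B} {g : B →ₗ[R] C}
    (hfg : Function.Exact f g) (hf : Function.Injective f) (hg : Function.Surjective g) {i : ℕ}
    (hC : Module.Finite R (Ext X (.of R C) i))
    (hB : Module.Finite R (Ext X (.of R B) (i + 1))) : Module.Finite R (Ext X (.of R A) (i + 1)) :=
  have hS := ModuleCat.shortExact_of_exact hfg hf hg
  .of_exact_middle (Ext.postcompOfLinear hS.extClass R X rfl)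
    (Ext.postcompOfLinear (Ext.mk₀ (ModuleCat.ofHom f)) R X (add_zero (i + 1)))
    fun x hx => Ext.covariant_sequence_exact₁ X hS x hx rfl

end FiniteExt

section FiniteExtQuot

open CategoryTheory Abelian

variable {R : Type u} [CommRing R] [IsNoetherianRing R]

lemma finite_ext_of_finite (A M : Type u) [AddCommGroup A] [Module R A] [Module.Finite R A]
    [AddCommGroup M] [Module R M] [Module.Finite R M] (i : ℕ) :
    Module.Finite R (Ext (ModuleCat.of R A) (ModuleCat.of R M) i) := by
  induction i generalizing A with
  | zero =>
    exact .equiv ((Ext.linearEquiv₀ (R := R) (X := ModuleCat.of R A) (Y := ModuleCat.of R M)).trans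
      (ModuleCat.homLinearEquiv (S := R))).symm
  | succ i ih =>
    obtain ⟨n, g, hg⟩ := Module.Finite.exists_fin' R A
    let e : ULift.{u} (Fin n) ≃ Fin n := Equiv.ulift
    let g' : (ULift.{u} (Fin n) → R) →ₗ[R] A :=
      g ∘ₗ (LinearEquiv.funCongrLeft R R e.symm).toLinearMap
    have hg' : Function.Surjective g' := hg.comp (LinearEquiv.surjective _)
    have hex : Function.Exact (LinearMap.ker g').subtype g' := LinearMap.exact_subtype_ker_map g'
    have hS := ModuleCat.shortExact_of_exact hex (Submodule.subtype_injective _) hg'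
    have := ih (LinearMap.ker g')
    refine .of_surjective (Ext.precompOfLinear hS.extClass R (.of R M) (add_comm 1 i)) fun x => ?_
    exact Ext.contravariant_sequence_exact₃ hS _ x (Ext.eq_zero_of_projective _)
      (add_comm 1 i)

/-- Cofiniteness of `0 :_M x` and `M ⧸ xM` for some `x ∈ I` implies that of `M`. Since `x`
annihilates `Ext^i_R(R/I, M)`, the composite `Ext^i(M) → Ext^i(xM) → Ext^i(M)` is zero; the first map
has finitely generated kernel because of `0 :_M x`, and the second because of `M ⧸ xM`. -/
lemma finite_extQuot_of_ker_of_quotient_range {I : Ideal R} {x : R} (hx : x ∈ I) {M : Type u}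
    [AddCommGroup M] [Module R M]
    (hker : ∀ i, Module.Finite R (ExtQuot I (LinearMap.ker (LinearMap.lsmul R M x)) i))
    (hquot : ∀ i, Module.Finite R (ExtQuot I (M ⧸ LinearMap.range (LinearMap.lsmul R M x)) i))
    (i : ℕ) : Module.Finite R (ExtQuot I M i) := by
  set φ := LinearMap.lsmul R M x
  set X := ModuleCat.of R (R ⧸ I)
  have hS₁ := ModuleCat.shortExact_of_exact φ.exact_ker_subtype_rangeRestrict
    (Submodule.subtype_injective _) φ.surjective_rangeRestrict
  have hS₂ := ModuleCat.shortExact_of_exact (LinearMap.exact_subtype_mkQ φ.range)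
    (Submodule.subtype_injective _) (Submodule.mkQ_surjective _)
  let p := Ext.postcompOfLinear (Ext.mk₀ (ModuleCat.ofHom φ.rangeRestrict)) R X (add_zero i)
  let j := Ext.postcompOfLinear (Ext.mk₀ (ModuleCat.ofHom φ.range.subtype)) R X (add_zero i)
  have hpj (e : ExtQuot I M i) : j (p e) = 0 := by
    have hφ : ModuleCat.ofHom φ.rangeRestrict ≫ ModuleCat.ofHom φ.range.subtype =
        x • 𝟙 (ModuleCat.of R M) := rfl
    have hX : x • 𝟙 X = 0 := by
      refine ModuleCat.hom_ext (LinearMap.ext fun (a : R ⧸ I) => ?_)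
      change x • a = 0
      rw [Algebra.smul_def, Ideal.Quotient.algebraMap_eq, Ideal.Quotient.eq_zero_iff_mem.2 hx,
        zero_mul]
    calc j (p e) = x • e := by
          simp [p, j, hφ, Ext.smul_eq_comp_mk₀]
      _ = (Ext.mk₀ (x • 𝟙 X)).comp e (zero_add i) := by simp [Ext.mk₀_smul]
      _ = 0 := by simp [hX]
  have hj : Module.Finite R (LinearMap.ker j) := by
    cases i with
    | zero =>
      have : Mono (ModuleCat.ofHom φ.range.subtype) :=
        (ModuleCat.mono_iff_injective _).2 (Submodule.subtype_injective _)
      have : LinearMap.ker j = ⊥ := LinearMap.ker_eq_bot.2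
        (Ext.postcomp_mk₀_injective_of_mono X (ModuleCat.ofHom φ.range.subtype))
      rw [this]
      infer_instance
    | succ i =>
      have := hquot i
      let δ := Ext.postcompOfLinear hS₂.extClass R X (a := i) (b := i + 1) rfl
      refine .of_fg (.of_le ((Submodule.fg_top (LinearMap.range δ)).1 Module.Finite.fg_top) ?_)
      intro y hy
      exact Ext.covariant_sequence_exact₁ X hS₂ y hy rfl
  have := hker i
  refine .of_exact_middle (Ext.postcompOfLinear
    (Ext.mk₀ (ModuleCat.ofHom (LinearMap.ker φ).subtype)) R X (add_zero i))
    (p.codRestrict (LinearMap.ker j) hpj) fun e he => ?_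
  exact Ext.covariant_sequence_exact₂ X hS₁ e (congrArg Subtype.val he)

end FiniteExtQuot

/-! ### Finiteness of `Ext` from finiteness in low degrees -/

section Cofinite

open CategoryTheory Abelian

variable {R : Type u} [CommRing R] {I : Ideal R}

/-- `Ext^0_R(R/I, M)` is `Hom_R(R/I, M)`. -/
noncomputable def extQuotZeroEquiv (I : Ideal R) (M : Type u) [AddCommGroup M] [Module R M] :
    ExtQuot I M 0 ≃ₗ[R] ((R ⧸ I) →ₗ[R] M) :=
  (Ext.linearEquiv₀ (R := R)).trans (ModuleCat.homLinearEquiv (S := R))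

lemma finite_torsionBySet_of_finite_extQuot_zero {M : Type u} [AddCommGroup M] [Module R M]
    (h : Module.Finite R (ExtQuot I M 0)) :
    Module.Finite R (Submodule.torsionBySet R M (I : Set R)) := by
  have := Module.Finite.equiv (extQuotZeroEquiv I M)
  refine .of_surjective ((LinearMap.applyₗ (R := R) (1 : R ⧸ I)).codRestrict
    (Submodule.torsionBySet R M (I : Set R)) (fun f : (R ⧸ I) →ₗ[R] M => ?_)) fun m => ?_
  · rw [Submodule.mem_torsionBySet_iff]
    rintro ⟨a, ha⟩
    have : a • (1 : R ⧸ I) = 0 := by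
      rw [Algebra.smul_def, mul_one, Ideal.Quotient.algebraMap_eq,
        Ideal.Quotient.eq_zero_iff_mem.2 ha]
    simp [← map_smul, this]
  · refine ⟨Submodule.liftQ I (LinearMap.toSpanSingleton R M m) fun a ha => ?_, Subtype.ext ?_⟩
    · exact (Submodule.mem_torsionBySet_iff _ _).1 m.2 ⟨a, ha⟩
    · exact one_smul R (m : M)

/-- For modules supported in `V(I) ∩ Z`, finite generation of `Ext^i_R(R/I, M)` for `i < n` implies
finite generation for all `i`. -/
def ExtQuotFiniteOfLT (I : Ideal R) (Z : Set (PrimeSpectrum R)) (n : ℕ) : Prop :=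
  ∀ (M : Type u) [AddCommGroup M] [Module R M],
    Module.support R M ⊆ PrimeSpectrum.zeroLocus (I : Set R) → Module.support R M ⊆ Z →
      (∀ i < n, Module.Finite R (ExtQuot I M i)) → ∀ i, Module.Finite R (ExtQuot I M i)

lemma not_lt_of_supportDim_le_one {M : Type u} [AddCommGroup M] [Module R M]
    (h : Module.supportDim R M ≤ 1) {p q r : PrimeSpectrum R} (hp : p ∈ Module.support R M)
    (hpq : p < q) : ¬ q < r := by
  intro hqr
  have hq := Module.mem_support_mono hpq.le hp
  have hr := Module.mem_support_mono hqr.le hq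
  let s : LTSeries (Module.support R M) :=
    ⟨2, ![⟨p, hp⟩, ⟨q, hq⟩, ⟨r, hr⟩], by intro i; fin_cases i <;> assumption⟩
  have : ((2 : ℕ) : WithBot ℕ∞) ≤ 1 := (Order.LTSeries.length_le_krullDim s).trans h
  exact absurd this (by decide)

variable [IsNoetherianRing R]

lemma extQuotFiniteOfLT_empty (I : Ideal R) : ExtQuotFiniteOfLT I ∅ 0 := by
  intro M _ _ _ hM _ i
  have : Subsingleton M := Module.support_eq_empty_iff.1 (Set.subset_empty_iff.1 hM)
  exact finite_ext_of_finite _ _ i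

/-- Raising the dimension by one: `Z'` consists of primes all of whose proper specializations lie in
`Z`. Noetherian induction on the annihilator handles `0 :_N x`, and the descending chain condition
modulo `Z` handles `xN`, unless `N` and `xN` agree modulo `Z`, in which case the assumption on `Z`
applies to `N ⧸ xN`. -/
lemma ExtQuotFiniteOfLT.succ {Z Z' : Set (PrimeSpectrum R)} {n : ℕ} (hn : n ≤ 1)
    (hZZ' : ∀ p ∈ Z', ∀ q, p < q → q ∈ Z) (hZ : ExtQuotFiniteOfLT I Z n) :
    ExtQuotFiniteOfLT I Z' (n + 1) := by
  intro M _ _ hMI hMZ hfin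
  obtain ⟨J, hJ⟩ : ∃ J, J ≤ Module.annihilator R M := ⟨_, le_rfl⟩
  induction J using WellFoundedGT.induction generalizing M with
  | ind J ihJ =>
  have hart : IsArtinianMod Z M := by
    have := finite_torsionBySet_of_finite_extQuot_zero (hfin 0 n.succ_pos)
    refine .of_torsionBySet_ideal hMI (isArtinianMod_of_finite fun p hp => hZZ' p (hMZ ?_))
    exact Module.support_subset_of_injective _ (Submodule.subtype_injective _) hp
  suffices h : ∀ N : Submodule R M, (∀ i < n + 1, Module.Finite R (ExtQuot I N i)) →
      ∀ i, Module.Finite R (ExtQuot I N i) by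
    have e : (⊤ : Submodule R M) ≃ₗ[R] M := Submodule.topEquiv
    exact fun i => finite_ext_of_linearEquiv _ e
      (h ⊤ (fun i hi => finite_ext_of_linearEquiv _ e.symm (hfin i hi)) i)
  intro N
  induction N using hart.wellFounded.induction with
  | h N ihN =>
  intro hN
  have hNI := (Module.support_subset_of_injective N.subtype N.subtype_injective).trans hMI
  have hNZ := (Module.support_subset_of_injective N.subtype N.subtype_injective).trans hMZ
  have hJN := hJ.trans (N.subtype.annihilator_le_of_injective N.subtype_injective)
  by_cases hIN : I ≤ Module.annihilator R N
  · have := finite_torsionBySet_of_finite_extQuot_zero (hN 0 n.succ_pos)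
    have htop : Submodule.torsionBySet R N (I : Set R) = ⊤ := by
      refine eq_top_iff.2 fun m _ => (Submodule.mem_torsionBySet_iff _ _).2 fun a => ?_
      exact Module.mem_annihilator.1 (hIN a.2) m
    rw [htop] at this
    have : Module.Finite R N := .equiv Submodule.topEquiv
    exact finite_ext_of_finite _ _
  obtain ⟨x, hxI, hxN⟩ := SetLike.not_le_iff_exists.1 hIN
  set φ := LinearMap.lsmul R N x
  have hex := φ.exact_ker_subtype_rangeRestrict
  have hex' : Function.Exact φ.range.subtype φ.range.mkQ := LinearMap.exact_subtype_mkQ φ.range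
  have hinj := (LinearMap.ker φ).subtype_injective
  have hinj' := φ.range.subtype_injective
  have hsurj := φ.surjective_rangeRestrict
  have hsurj' := φ.range.mkQ_surjective
  -- At this stage only `Ext^0(xN)` is known to be finitely generated, since it embeds into
  -- `Ext^0(N)`. This controls `Ext^1(0 :_N x)` but nothing higher, whence `n ≤ 1`.
  have hker : ∀ i, Module.Finite R (ExtQuot I (LinearMap.ker φ) i) := by
    refine ihJ (J ⊔ Ideal.span {x}) ?_ (LinearMap.ker φ)
      ((Module.support_subset_of_injective _ hinj).trans hNI)
      ((Module.support_subset_of_injective _ hinj).trans hNZ) (fun i hi => ?_) ?_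
    · refine lt_of_le_of_ne le_sup_left fun h => hxN (hJN ?_)
      rw [h]
      exact le_sup_right (a := J) (Ideal.mem_span_singleton_self x)
    · cases i with
      | zero => exact finite_ext_zero_of_injective _ hinj (hN 0 hi)
      | succ i =>
        obtain rfl : i = 0 := by lia
        exact finite_ext_left _ hex hinj hsurj
          (finite_ext_zero_of_injective _ hinj' (hN 0 n.succ_pos)) (hN 1 hi)
    · refine sup_le (hJN.trans (LinearMap.annihilator_le_of_injective _ hinj)) ?_
      rw [Ideal.span_singleton_le_iff_mem, Module.mem_annihilator]
      exact fun m => Subtype.ext m.2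
  have hrange : ∀ i < n + 1, Module.Finite R (ExtQuot I φ.range i) := fun i hi =>
    finite_ext_right _ hex hinj hsurj (hN i hi) (hker (i + 1))
  by_cases hlt : N.LEMod Z (φ.range.map N.subtype)
  · refine finite_extQuot_of_ker_of_quotient_range hxI hker (hZ _
      ((Module.support_subset_of_surjective _ hsurj').trans hNI) (Submodule.lEMod_top_iff.1 ?_)
      fun i hi => finite_ext_right _ hex' hinj' hsurj' (hN i (by lia)) (hrange (i + 1) (by lia)))
    intro p hp m _
    obtain ⟨r, hr, m', hm', h⟩ := hlt p hp m m.2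
    exact ⟨r, hr, by rwa [show r • m = m' from Subtype.ext h.symm]⟩
  · have e := Submodule.equivSubtypeMap N φ.range
    have := ihN _ ⟨Submodule.map_subtype_le _ _, hlt⟩
      fun i hi => finite_ext_of_linearEquiv _ e (hrange i hi)
    exact fun i => finite_ext_middle _ hex hinj hsurj (hker i)
      (finite_ext_of_linearEquiv _ e.symm (this i))

end Cofinite

theorem theorem3p1 {R : Type u} [CommRing R] [IsNoetherianRing R] (I : Ideal R)
    (M : Type u) [AddCommGroup M] [Module R M]
    (hFD : IsFDLE R 1 M)
    (hsupp : Module.support R M ⊆ PrimeSpectrum.zeroLocus (I : Set R)) :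
    IsCofiniteModule I M ↔
      (Module.Finite R ((R ⧸ I) →ₗ[R] M) ∧ Module.Finite R (ExtQuot I M 1)) := by
  refine ⟨fun ⟨_, h⟩ => ⟨have := h 0; .equiv (extQuotZeroEquiv I M), h 1⟩,
    fun ⟨h₀, h₁⟩ => ⟨hsupp, ?_⟩⟩
  obtain ⟨N, hN, hdim⟩ := hFD
  have : Module.Finite R N := .of_fg hN
  have hex : Function.Exact N.subtype N.mkQ := LinearMap.exact_subtype_mkQ N
  have h₀' : Module.Finite R (ExtQuot I M 0) := .equiv (extQuotZeroEquiv I M).symm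
  -- From the empty set to the maximal primes, and on to the primes of dimension at most one.
  have key := ((extQuotFiniteOfLT_empty I).succ (Z' := {p | ∀ q, ¬ p < q}) zero_le_one
      fun p hp q hpq => hp q hpq).succ (Z' := {p | ∀ q r, p < q → ¬ q < r}) le_rfl
      fun p hp q hpq r => hp q r hpq
  have hquot := key (M ⧸ N)
    ((Module.support_subset_of_surjective _ N.mkQ_surjective).trans hsupp)
    (fun p hp q r => not_lt_of_supportDim_le_one hdim hp) fun i hi =>
      finite_ext_right _ hex N.subtype_injective N.mkQ_surjective
        (by interval_cases i <;> assumption) (finite_ext_of_finite _ _ _)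
  exact fun i => finite_ext_middle _ hex N.subtype_injective N.mkQ_surjective
    (finite_ext_of_finite _ _ i) (hquot i)
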